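/- For a set $\Omega \subseteq \mathbb{R}$ put $I := \Omega \cap [0,\infty)$. Call $\Omega$ *modulus-closed* if $x \in \Omega$ implies $|x| \in \Omega$; of *pd-type* if for every $x \in \Omega \setminus I$ there exists $\epsilon > 0$ with $|x| + \epsilon \in I$; and of *psd-type* if for every $x \in \Omega \setminus I$ there exists $\delta > 0$ with $|x| - \delta \in I$. Let $M_n(\Omega)$ be the set of $n \times n$ matrices with entries in $\Omega$, and for $f : \Omega \to \mathbb{C}$ and $A = (a_{ij}) \in M_n(\Omega)$ let $f[A] := (f(a_{ij}))$ be the matrix obtained by applying $f$ entrywise. Positive definite and positive semidefinite matrices are Hermitian by definition. **Theorem B.** Fix an integer $n \geq 3$. Let $\Omega \subseteq \mathbb{R}$ be modulus-closed, of pd-type, and such that $I = \Omega \cap [0,\infty)$ is a nondegenerate interval (an interval with more than one point). The following are equivalent for a function $f : \Omega \to \mathbb{C}$: 1. For every symmetric matrix $A \in M_n(\Omega)$: $A$ is positive definite if and only if $f[A]$ is positive definite. 2. There exists a real $\alpha > 0$ such that $f(x) = \alpha x$ for all $x \in \Omega$. The same equivalence holds if "pd-type" is replaced by "psd-type" and "positive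 definite" by "positive semidefinite". -/

import Mathlib

open scoped ComplexOrder

/-- The nonnegative part `I = Ω ∩ [0, ∞)` of a real domain `Ω`. -/
def nonnegPart (Ω : Set ℝ) : Set ℝ := Ω ∩ Set.Ici 0

/-- `Ω` is modulus-closed: `x ∈ Ω` implies `|x| ∈ Ω`. -/
def ModulusClosed (Ω : Set ℝ) : Prop := ∀ x ∈ Ω, |x| ∈ Ω

/-- `Ω` is of pd-type: for every `x ∈ Ω` outside `I = Ω ∩ [0, ∞)`
there is `ε > 0` with `|x| + ε ∈ I`. -/
def IsPDType (Ω : Set ℝ) : Prop :=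
  ∀ x ∈ Ω \ nonnegPart Ω, ∃ ε : ℝ, 0 < ε ∧ |x| + ε ∈ nonnegPart Ω

/-- `Ω` is of psd-type: for every `x ∈ Ω` outside `I = Ω ∩ [0, ∞)`
there is `δ > 0` with `|x| - δ ∈ I`. -/
def IsPSDType (Ω : Set ℝ) : Prop :=
  ∀ x ∈ Ω \ nonnegPart Ω, ∃ δ : ℝ, 0 < δ ∧ |x| - δ ∈ nonnegPart Ω

/-- `f : Ω → ℂ` is a positive definite sign preserver on `M_n(Ω)`: a symmetric matrix `A` with
entries in `Ω` is positive definite if and only if the entrywise image `f[A] = (f (a_ij))` is a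
positive definite complex matrix (in particular, a Hermitian one). -/
def IsPDSignPreserver (n : ℕ) (Ω : Set ℝ) (f : Ω → ℂ) : Prop :=
  ∀ A : Matrix (Fin n) (Fin n) Ω, A.IsSymm →
    ((A.map (fun x : Ω => (x : ℝ))).PosDef ↔ (A.map f).PosDef)

/-- `f : Ω → ℂ` is a positive semidefinite sign preserver on `M_n(Ω)`: a symmetric matrix `A` with
entries in `Ω` is positive semidefinite if and only if the entrywise image `f[A] = (f (a_ij))` is a
positive semidefinite complex matrix (in particular, a Hermitian one). -/
def IsPSDSignPreserver (n : ℕ) (Ω : Set ℝ) (f : Ω → ℂ) : Prop :=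
  ∀ A : Matrix (Fin n) (Fin n) Ω, A.IsSymm →
    ((A.map (fun x : Ω => (x : ℝ))).PosSemidef ↔ (A.map f).PosSemidef)

/-!
A sign preserver `f` is real-valued, since every point of `Ω` is an entry of some positive definite
(resp. semidefinite) symmetric matrix over `Ω`. On `I = Ω ∩ [0, ∞)` it is strictly increasing, as
one sees from the matrices with two distinct entries, one on and one off the diagonal.

Size `n` reduces to size three: repeating the last row and column of a `3 × 3` matrix, with larger
new diagonal entries in the definite case, does not change its sign (`posDef_repeatLast_iff`,
`posSemidef_repeatLast_iff`), and the construction commutes with entrywise maps.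

Linearity on `I` comes from the matrices with rows `(a, b, b)`, `(b, c, d)`, `(b, d, c)`, where
`0 ≤ d < c`. Such a matrix is positive definite if and only if `a (c + d) > 2 b ^ 2`, so `f` respects
the comparison of `a (c + d)` with `2 b ^ 2`. Letting `a` and `b` tend to `(c + d) / 2` yields
`f c + f d = 2 f ((c + d) / 2)` (`midpoint_of_swap`), hence `f` is affine on the interior of `I`;
letting `b` tend to the geometric mean of `a` and `m = (c + d) / 2` yields
`f a * f m = f (√(a m)) ^ 2` (`mul_eq_sq_of_swap`), which removes the constant term and settles the
endpoints (`exists_linear_of_swap`). Only implications common to the definite and the semidefinite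
case enter, so this part is shared.

For negative `x = -y` in `Ω`, a `2 × 2` minor gives `|f x| ≤ α y`. A `3 × 3` matrix over `{x} ∪ I`
that is singular or indefinite but would become positive definite if `x` were replaced by a number
of smaller modulus gives `|f x| = α y`; the pd-type (resp. psd-type) assumption provides the room
for it in `I`. Finally `f x = α y` is impossible, because a sign pattern with one negative pair of
entries would then have the same image as the all-positive one.
-/

/-! ### Real matrices viewed as complex matrices -/

namespace Matrix

variable {n : Type*} [Fintype n]

/-- The Hermitian form of a real symmetric matrix at `x + iy` is the sum of its values at `x` and
at `y`. -/
theorem star_dotProduct_map_ofReal_mulVec {A : Matrix n n ℝ} (hA : A.IsSymm) (z : n → ℂ) :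
    star z ⬝ᵥ (A.map Complex.ofReal *ᵥ z) =
      (((fun i => (z i).re) ⬝ᵥ (A *ᵥ fun i => (z i).re) +
        (fun i => (z i).im) ⬝ᵥ (A *ᵥ fun i => (z i).im) : ℝ) : ℂ) := by
  have key : ∑ i, ∑ j, (z i).re * (A i j * (z j).im) =
      ∑ i, ∑ j, (z i).im * (A i j * (z j).re) := by
    rw [Finset.sum_comm]
    refine Finset.sum_congr rfl fun i _ => Finset.sum_congr rfl fun j _ => ?_
    rw [hA.apply i j]; ring
  simp only [dotProduct, mulVec, Finset.mul_sum, Pi.star_apply, map_apply]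
  apply Complex.ext
  · simp only [Complex.re_sum, Complex.ofReal_re, ← Finset.sum_add_distrib]
    refine Finset.sum_congr rfl fun i _ => Finset.sum_congr rfl fun j _ => ?_
    simp
  · simp only [Complex.im_sum, Complex.ofReal_im]
    rw [← sub_eq_zero] at key
    rw [← key]
    simp only [← Finset.sum_sub_distrib]
    refine Finset.sum_congr rfl fun i _ => Finset.sum_congr rfl fun j _ => ?_
    simp
    ring

theorem isHermitian_map_ofReal_iff {m : Type*} {A : Matrix m m ℝ} :
    (A.map Complex.ofReal).IsHermitian ↔ A.IsHermitian := by
  simp only [IsHermitian.ext_iff, map_apply, star_trivial, Complex.star_def, Complex.conj_ofReal,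
    Complex.ofReal_inj]

theorem posSemidef_map_ofReal_iff {A : Matrix n n ℝ} :
    (A.map Complex.ofReal).PosSemidef ↔ A.PosSemidef := by
  rw [posSemidef_iff_dotProduct_mulVec, posSemidef_iff_dotProduct_mulVec,
    isHermitian_map_ofReal_iff]
  refine and_congr_right fun hA => ?_
  have hs : A.IsSymm := isHermitian_iff_isSymm.1 hA
  simp only [star_dotProduct_map_ofReal_mulVec hs, Complex.zero_le_real]
  refine ⟨fun h x => ?_, fun h z => add_nonneg (by simpa using h fun i => (z i).re)
    (by simpa using h fun i => (z i).im)⟩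
  simpa using h fun i => (x i : ℂ)

theorem posDef_map_ofReal_iff {A : Matrix n n ℝ} :
    (A.map Complex.ofReal).PosDef ↔ A.PosDef := by
  constructor
  · intro h
    have hA := isHermitian_map_ofReal_iff.1 h.isHermitian
    have hs : A.IsSymm := isHermitian_iff_isSymm.1 hA
    refine .of_dotProduct_mulVec_pos hA fun x hx => ?_
    have hx' : (fun i => (x i : ℂ)) ≠ 0 := fun h0 => hx <| funext fun i => by
      simpa using congrFun h0 i
    have := h.dotProduct_mulVec_pos hx'
    rw [star_dotProduct_map_ofReal_mulVec hs, Complex.zero_lt_real] at this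
    simpa using this
  · intro h
    have hs : A.IsSymm := isHermitian_iff_isSymm.1 h.isHermitian
    refine .of_dotProduct_mulVec_pos (isHermitian_map_ofReal_iff.2 h.isHermitian) fun z hz => ?_
    rw [star_dotProduct_map_ofReal_mulVec hs, Complex.zero_lt_real]
    by_cases hre : (fun i => (z i).re) = 0
    · have him : (fun i => (z i).im) ≠ 0 := fun him => hz <| funext fun i =>
        Complex.ext (congrFun hre i) (congrFun him i)
      exact add_pos_of_nonneg_of_pos
        (by simpa using h.posSemidef.dotProduct_mulVec_nonneg fun i => (z i).re)
        (by simpa using h.dotProduct_mulVec_pos him)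
    · exact add_pos_of_pos_of_nonneg (by simpa using h.dotProduct_mulVec_pos hre)
        (by simpa using h.posSemidef.dotProduct_mulVec_nonneg fun i => (z i).im)

theorem posDef_smul_iff {m : Type*} {A : Matrix m m ℝ} {r : ℝ} (hr : 0 < r) :
    (r • A).PosDef ↔ A.PosDef :=
  ⟨fun h => by simpa [smul_smul, inv_mul_cancel₀ hr.ne'] using h.smul (inv_pos.2 hr),
    fun h => h.smul hr⟩

theorem posSemidef_smul_iff {m : Type*} {A : Matrix m m ℝ} {r : ℝ} (hr : 0 < r) :
    (r • A).PosSemidef ↔ A.PosSemidef :=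
  ⟨fun h => by simpa [smul_smul, inv_mul_cancel₀ hr.ne'] using h.smul (inv_pos.2 hr).le,
    fun h => h.smul hr.le⟩

/-! ### Matrices with constant diagonal and off-diagonal entries of constant modulus -/

variable [DecidableEq n]

/-- The matrix with diagonal entries `t` and off-diagonal entries `y * s i * s j`; the vector `s`
is meant to have entries `±1`. -/
def signPattern (t y : ℝ) (s : n → ℝ) : Matrix n n ℝ :=
  of fun i j => if i = j then t else y * s i * s j

theorem signPattern_eq {m : Type*} [DecidableEq m] (t y : ℝ) {s : m → ℝ}
    (hs : ∀ i, s i * s i = 1) :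
    signPattern t y s = (t - y) • (1 : Matrix m m ℝ) + y • vecMulVec s (star s) := by
  ext i j
  by_cases h : i = j
  · subst h
    simp [signPattern, vecMulVec_apply, hs]
  · simp [signPattern, vecMulVec_apply, h, mul_assoc]

theorem posDef_signPattern {t y : ℝ} (hy : 0 ≤ y) (h : y < t) {s : n → ℝ}
    (hs : ∀ i, s i * s i = 1) : (signPattern t y s).PosDef := by
  rw [signPattern_eq t y hs]
  exact (PosDef.one.smul (sub_pos.2 h)).add_posSemidef
    ((posSemidef_vecMulVec_self_star s).smul hy)

theorem posSemidef_signPattern {t y : ℝ} (hy : 0 ≤ y) (h : y ≤ t) {s : n → ℝ}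
    (hs : ∀ i, s i * s i = 1) : (signPattern t y s).PosSemidef := by
  rw [signPattern_eq t y hs]
  exact (PosSemidef.one.smul (sub_nonneg.2 h)).add
    ((posSemidef_vecMulVec_self_star s).smul hy)

/-- The `2 × 2` principal minors of a positive semidefinite matrix are nonnegative. -/
theorem PosSemidef.sq_le_mul_diag {m : Type*} {A : Matrix m m ℝ} (hA : A.PosSemidef) (i j : m) :
    A i j ^ 2 ≤ A i i * A j j := by
  have h := (hA.submatrix ![i, j]).det_nonneg
  have hs : A j i = A i j := by simpa using hA.isHermitian.apply i j
  rw [det_fin_two] at h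
  simp [hs] at h
  nlinarith

/-- The `2 × 2` principal minors of a positive definite matrix are positive. -/
theorem PosDef.sq_lt_mul_diag {m : Type*} {A : Matrix m m ℝ} (hA : A.PosDef) {i j : m} (hij : i ≠ j) :
    A i j ^ 2 < A i i * A j j := by
  have hinj : Function.Injective ![i, j] := by
    intro a b
    fin_cases a <;> fin_cases b <;> simp [hij, hij.symm]
  have h := (hA.submatrix hinj).det_pos
  have hs : A j i = A i j := by simpa using hA.isHermitian.apply i j
  rw [det_fin_two] at h
  simp [hs] at h
  nlinarith

/-! ### Symmetric matrices of size three -/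

/-- The symmetric `3 × 3` matrix with rows `(a, b, c)`, `(b, d, e)`, `(c, e, r)`. -/
def symThree (a b c d e r : ℝ) : Matrix (Fin 3) (Fin 3) ℝ :=
  !![a, b, c; b, d, e; c, e, r]

theorem det_symThree (a b c d e r : ℝ) :
    (symThree a b c d e r).det =
      a * d * r + 2 * b * c * e - a * e ^ 2 - d * c ^ 2 - r * b ^ 2 := by
  simp [symThree, det_fin_three]
  ring

theorem isHermitian_symThree (a b c d e r : ℝ) : (symThree a b c d e r).IsHermitian := by
  refine IsHermitian.ext fun i j => ?_
  fin_cases i <;> fin_cases j <;> simp [symThree]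

theorem map_symThree (g : ℝ → ℝ) (a b c d e r : ℝ) :
    (symThree a b c d e r).map g = symThree (g a) (g b) (g c) (g d) (g e) (g r) := by
  ext i j
  fin_cases i <;> fin_cases j <;> rfl

/-- Sylvester's criterion in dimension three: positive leading principal minors imply positive
definiteness. -/
theorem posDef_symThree {a b c d e r : ℝ} (h₁ : 0 < a) (h₂ : b ^ 2 < a * d)
    (h₃ : 0 < a * d * r + 2 * b * c * e - a * e ^ 2 - d * c ^ 2 - r * b ^ 2) :
    (symThree a b c d e r).PosDef := by
  refine .of_dotProduct_mulVec_pos (isHermitian_symThree ..) fun v hv => ?_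
  have hD : 0 < a * d - b ^ 2 := sub_pos.2 h₂
  have hq : star v ⬝ᵥ (symThree a b c d e r *ᵥ v) =
      v 0 * (a * v 0 + b * v 1 + c * v 2) + v 1 * (b * v 0 + d * v 1 + e * v 2) +
        v 2 * (c * v 0 + e * v 1 + r * v 2) := by
    simp [symThree, dotProduct, mulVec, Fin.sum_univ_three]
  rw [hq]
  -- Completing squares twice, after multiplication by the first two leading minors.
  have hid : a * (a * d - b ^ 2) *
      (v 0 * (a * v 0 + b * v 1 + c * v 2) + v 1 * (b * v 0 + d * v 1 + e * v 2) +
        v 2 * (c * v 0 + e * v 1 + r * v 2)) =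
      (a * d - b ^ 2) * (a * v 0 + b * v 1 + c * v 2) ^ 2 +
      ((a * d - b ^ 2) * v 1 + (a * e - b * c) * v 2) ^ 2 +
      a * (a * d * r + 2 * b * c * e - a * e ^ 2 - d * c ^ 2 - r * b ^ 2) * v 2 ^ 2 := by ring
  refine pos_of_mul_pos_right (lt_of_le_of_ne (hid ▸ by positivity) fun h0 => hv ?_)
    (mul_pos h₁ hD).le
  rw [hid] at h0
  have hz1 : 0 ≤ (a * d - b ^ 2) * (a * v 0 + b * v 1 + c * v 2) ^ 2 := by positivity
  have hz2 : 0 ≤ ((a * d - b ^ 2) * v 1 + (a * e - b * c) * v 2) ^ 2 := by positivity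
  have hz3 : 0 ≤ a * (a * d * r + 2 * b * c * e - a * e ^ 2 - d * c ^ 2 - r * b ^ 2) *
    v 2 ^ 2 := by positivity
  have e3 : v 2 = 0 := by
    have : a * (a * d * r + 2 * b * c * e - a * e ^ 2 - d * c ^ 2 - r * b ^ 2) * v 2 ^ 2 = 0 := by
      linarith
    simpa [h₁.ne', h₃.ne'] using this
  have e2 : v 1 = 0 := by
    have : ((a * d - b ^ 2) * v 1 + (a * e - b * c) * v 2) ^ 2 = 0 := by linarith
    simpa [e3, hD.ne'] using this
  have e1 : v 0 = 0 := by
    have : (a * d - b ^ 2) * (a * v 0 + b * v 1 + c * v 2) ^ 2 = 0 := by linarith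
    simpa [e3, e2, hD.ne', h₁.ne'] using this
  ext i
  fin_cases i <;> simpa

/-- Exchanging the last two coordinates fixes `symThree a b b c d c`, and splits its quadratic form
into the antisymmetric part, with eigenvalue `c - d`, and a `2 × 2` symmetric part. -/
theorem posDef_symThree_swap {a b c d : ℝ} (hd : 0 ≤ d) (hdc : d < c)
    (h : 2 * b ^ 2 < a * (c + d)) : (symThree a b b c d c).PosDef := by
  have ha : 0 < a := by
    by_contra! ha
    nlinarith [sq_nonneg b, mul_nonneg (neg_nonneg.2 ha) (by linarith : 0 ≤ c + d)]
  refine posDef_symThree ha (by nlinarith) ?_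
  have := mul_pos (sub_pos.2 hdc) (sub_pos.2 h)
  nlinarith

theorem le_of_posSemidef_symThree_swap {a b c d : ℝ} (hdc : d < c)
    (h : (symThree a b b c d c).PosSemidef) : 2 * b ^ 2 ≤ a * (c + d) := by
  have := h.det_nonneg
  rw [det_symThree] at this
  have h' : 0 ≤ (c - d) * (a * (c + d) - 2 * b ^ 2) := by nlinarith
  linarith [nonneg_of_mul_nonneg_right h' (sub_pos.2 hdc)]

/-! ### Enlarging a matrix of size three -/

/-- The map `Fin n → Fin 3` sending every index from the third one on to the last index. -/
def clipThree {n : ℕ} (i : Fin n) : Fin 3 := ⟨min i.val 2, by omega⟩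

/-- The enlargement of a `3 × 3` matrix `B` to size `n`: the last row and column are repeated, and
the additional diagonal entries are set to `t`. -/
def repeatLast {R : Type*} (n : ℕ) (B : Matrix (Fin 3) (Fin 3) R) (t : R) :
    Matrix (Fin n) (Fin n) R :=
  Matrix.of fun i j => if i = j ∧ 3 ≤ i.val then t else B (clipThree i) (clipThree j)

theorem map_repeatLast {R S : Type*} (n : ℕ) (g : R → S) (B : Matrix (Fin 3) (Fin 3) R) (t : R) :
    (repeatLast n B t).map g = repeatLast n (B.map g) (g t) := by
  ext i j
  simp only [repeatLast, Matrix.map_apply, Matrix.of_apply]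
  split_ifs <;> rfl

theorem repeatLast_submatrix {R : Type*} {n : ℕ} (hn : 3 ≤ n) (B : Matrix (Fin 3) (Fin 3) R)
    (t : R) : (repeatLast n B t).submatrix (Fin.castLE hn) (Fin.castLE hn) = B := by
  have h : ∀ i : Fin 3, clipThree (Fin.castLE hn i) = i := fun i => by
    ext; simp [clipThree]; omega
  ext i j
  simp [repeatLast, h]

theorem repeatLast_eq_add (n : ℕ) (B : Matrix (Fin 3) (Fin 3) ℝ) (t : ℝ) :
    repeatLast n B t = B.submatrix clipThree clipThree +
      Matrix.diagonal fun i : Fin n => if 3 ≤ i.val then t - B 2 2 else 0 := by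
  ext i j
  by_cases hij : i = j
  · subst hij
    by_cases hi : 3 ≤ i.val
    · have : clipThree i = 2 := by ext; simp [clipThree]; omega
      simp [repeatLast, hi, this]
    · simp [repeatLast, hi]
  · simp [repeatLast, hij]

theorem posSemidef_repeatLast_iff {n : ℕ} (hn : 3 ≤ n) {B : Matrix (Fin 3) (Fin 3) ℝ} {t : ℝ}
    (ht : B 2 2 ≤ t) : (repeatLast n B t).PosSemidef ↔ B.PosSemidef := by
  refine ⟨fun h => by simpa [repeatLast_submatrix hn] using h.submatrix (Fin.castLE hn),
    fun h => ?_⟩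
  rw [repeatLast_eq_add]
  refine (h.submatrix _).add (Matrix.PosSemidef.diagonal fun i => ?_)
  dsimp only [Pi.zero_apply]
  split_ifs
  · exact sub_nonneg.2 ht
  · exact le_rfl

theorem posDef_repeatLast_iff {n : ℕ} (hn : 3 ≤ n) {B : Matrix (Fin 3) (Fin 3) ℝ} {t : ℝ}
    (ht : B 2 2 < t) : (repeatLast n B t).PosDef ↔ B.PosDef := by
  refine ⟨fun h => by
    simpa [repeatLast_submatrix hn] using h.submatrix (Fin.castLE_injective hn), fun h => ?_⟩
  refine .of_dotProduct_mulVec_pos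
    ((posSemidef_repeatLast_iff hn ht.le).2 h.posSemidef).isHermitian fun x hx => ?_
  set d : Fin n → ℝ := fun i => if 3 ≤ i.val then t - B 2 2 else 0 with hd
  have hdiag : star x ⬝ᵥ (Matrix.diagonal d *ᵥ x) = ∑ i, d i * x i ^ 2 := by
    simp only [dotProduct, Matrix.mulVec_diagonal, Pi.star_apply, star_trivial]
    exact Finset.sum_congr rfl fun i _ => by ring
  have hd0 : ∀ i, 0 ≤ d i * x i ^ 2 := fun i => by
    simp only [hd]
    split_ifs
    · exact mul_nonneg (sub_nonneg.2 ht.le) (sq_nonneg _)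
    · simp
  have hB := h.posSemidef.submatrix (clipThree (n := n))
  rw [repeatLast_eq_add, Matrix.add_mulVec, dotProduct_add, hdiag]
  by_cases hx3 : ∃ i : Fin n, 3 ≤ i.val ∧ x i ≠ 0
  · obtain ⟨i, hi, hxi⟩ := hx3
    refine add_pos_of_nonneg_of_pos (hB.dotProduct_mulVec_nonneg x) ?_
    refine Finset.sum_pos' (fun i _ => hd0 i) ⟨i, Finset.mem_univ i, ?_⟩
    simp only [hd, hi, if_true]
    have := sub_pos.2 ht
    positivity
  · push Not at hx3
    refine add_pos_of_pos_of_nonneg ?_ (Finset.sum_nonneg fun i _ => hd0 i)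
    -- The vector is supported on the first three coordinates.
    have hsum : ∀ F : Fin n → ℝ, (∀ i, 3 ≤ i.val → F i = 0) →
        ∑ i, F i = ∑ k : Fin 3, F (Fin.castLE hn k) := by
      intro F hF
      refine (Finset.sum_subset (Finset.subset_univ _) fun i _ hi => hF i ?_).symm.trans
        (Finset.sum_map Finset.univ (Fin.castLEEmb hn) F)
      by_contra! hlt
      exact hi (Finset.mem_map.2 ⟨⟨i.val, hlt⟩, Finset.mem_univ _, by ext; simp⟩)
    have hclip : ∀ i : Fin 3, clipThree (Fin.castLE hn i) = i := fun i => by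
      ext; simp [clipThree]; omega
    have hval : star x ⬝ᵥ (B.submatrix clipThree clipThree *ᵥ x) =
        star (fun k => x (Fin.castLE hn k)) ⬝ᵥ (B *ᵥ fun k => x (Fin.castLE hn k)) := by
      simp only [dotProduct, Matrix.mulVec, Pi.star_apply, star_trivial]
      rw [hsum _ fun i hi => by rw [hx3 i hi, zero_mul]]
      refine Finset.sum_congr rfl fun k _ => ?_
      rw [hsum _ fun i hi => by rw [hx3 i hi, mul_zero]]
      simp [hclip]
    rw [hval]
    refine h.dotProduct_mulVec_pos fun h0 => hx (funext fun i => ?_)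
    by_cases hi : 3 ≤ i.val
    · exact hx3 i hi
    · exact congrFun h0 ⟨i.val, by omega⟩

end Matrix

/-! ### Midpoint-affine functions on an interval -/

section Analysis

open Set Filter Topology

theorem nonpos_of_midpoint {φ : ℝ → ℝ} {u v : ℝ} (huv : u ≤ v) (hb : BddAbove (φ '' Icc u v))
    (hmid : ∀ c ∈ Icc u v, ∀ d ∈ Icc u v, φ c + φ d = 2 * φ ((c + d) / 2))
    (hu : φ u = 0) (hv : φ v = 0) : ∀ x ∈ Icc u v, φ x ≤ 0 := by
  intro x hx
  by_contra! hpos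
  set M := sSup (φ '' Icc u v)
  have hle : ∀ y ∈ Icc u v, φ y ≤ M := fun y hy => le_csSup hb (mem_image_of_mem φ hy)
  have hM : 0 < M := hpos.trans_le (hle x hx)
  -- Reflecting the nearer endpoint in a point where `φ` exceeds `M / 2` gives a value above `M`.
  obtain ⟨_, ⟨y, hy, rfl⟩, hlt⟩ := exists_lt_of_lt_csSup
    ((nonempty_Icc.2 huv).image φ) (half_lt_self hM)
  rcases le_total y ((u + v) / 2) with h | h
  · have hz : 2 * y - u ∈ Icc u v := ⟨by linarith [hy.1], by linarith⟩
    have := hmid u (left_mem_Icc.2 huv) _ hz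
    rw [show (u + (2 * y - u)) / 2 = y by ring] at this
    linarith [hle _ hz]
  · have hz : 2 * y - v ∈ Icc u v := ⟨by linarith, by linarith [hy.2]⟩
    have := hmid v (right_mem_Icc.2 huv) _ hz
    rw [show (v + (2 * y - v)) / 2 = y by ring] at this
    linarith [hle _ hz]

/-- A monotone midpoint-affine function on a compact interval is given by linear interpolation
between the endpoints. -/
theorem interpolation_of_midpoint {g : ℝ → ℝ} {u v : ℝ} (huv : u < v)
    (hg : MonotoneOn g (Icc u v))
    (hmid : ∀ c ∈ Icc u v, ∀ d ∈ Icc u v, g c + g d = 2 * g ((c + d) / 2)) :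
    ∀ x ∈ Icc u v, (v - u) * g x = (v - x) * g u + (x - u) * g v := by
  intro x hx
  have hu := left_mem_Icc.2 huv.le
  have hv := right_mem_Icc.2 huv.le
  have hguv : g u ≤ g v := hg hu hv huv.le
  have hd := sub_pos.2 huv
  have h₁ := nonpos_of_midpoint (φ := fun y => (v - u) * g y - ((v - y) * g u + (y - u) * g v))
    huv.le ⟨(v - u) * (g v - g u), by
      rintro _ ⟨y, hy, rfl⟩
      have := hg hy hv hy.2
      nlinarith [mul_nonneg (sub_nonneg.2 hy.1) (sub_nonneg.2 hguv)]⟩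
    (fun c hc d hd => by linear_combination (v - u) * hmid c hc d hd) (by ring) (by ring) x hx
  have h₂ := nonpos_of_midpoint (φ := fun y => ((v - y) * g u + (y - u) * g v) - (v - u) * g y)
    huv.le ⟨(v - u) * (g v - g u), by
      rintro _ ⟨y, hy, rfl⟩
      have := hg hu hy hy.1
      nlinarith [mul_nonneg (sub_nonneg.2 hy.2) (sub_nonneg.2 hguv)]⟩
    (fun c hc d hd => by linear_combination -(v - u) * hmid c hc d hd) (by ring) (by ring) x hx
  linarith

theorem exists_affine_of_midpoint {g : ℝ → ℝ} {J : Set ℝ} (hJ : J.OrdConnected)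
    (hJ' : J.Nontrivial) (hg : MonotoneOn g J)
    (hmid : ∀ c ∈ J, ∀ d ∈ J, g c + g d = 2 * g ((c + d) / 2)) :
    ∃ α β : ℝ, ∀ x ∈ J, g x = α * x + β := by
  have key : ∀ u ∈ J, ∀ v ∈ J, u < v → ∀ x ∈ Icc u v,
      (v - u) * g x = (v - x) * g u + (x - u) * g v := fun u hu v hv huv =>
    interpolation_of_midpoint huv (hg.mono (hJ.out hu hv))
      fun c hc d hd => hmid c (hJ.out hu hv hc) d (hJ.out hu hv hd)
  obtain ⟨p, hp, q, hq, hpq⟩ := hJ'.exists_lt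
  have hd := (sub_pos.2 hpq).ne'
  refine ⟨(g q - g p) / (q - p), (q * g p - p * g q) / (q - p), fun x hx => ?_⟩
  field_simp
  rcases lt_or_ge x p with h | h
  · linear_combination -key x hx q hq (h.trans hpq) p ⟨h.le, hpq.le⟩
  · rcases le_or_gt x q with h' | h'
    · linear_combination key p hp q hq hpq x ⟨h, h'⟩
    · linear_combination -key p hp x hx (hpq.trans h') q ⟨hpq.le, h'.le⟩

/-! ### The functional inequality on the nonnegative part of the domain -/

/-- The one-sided limits of `g` at the midpoint `m` of `c` and `d` are compared with `g c + g d`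
through the matrices `symThree a b b c d c` with `a` and `b` tending to `m` from the same side;
together with monotonicity this leaves no room for a jump at `m`. -/
theorem midpoint_of_swap {g : ℝ → ℝ} {J : Set ℝ} (hJ : J.OrdConnected) (hJ0 : ∀ x ∈ J, 0 ≤ x)
    (hg : StrictMonoOn g J) (hpos : ∀ x ∈ J, 0 < g x)
    (h₁ : ∀ a ∈ J, ∀ b ∈ J, ∀ c ∈ J, ∀ d ∈ J, d < c →
      2 * b ^ 2 < a * (c + d) → 2 * g b ^ 2 ≤ g a * (g c + g d))
    (h₂ : ∀ a ∈ J, ∀ b ∈ J, ∀ c ∈ J, ∀ d ∈ J, d < c →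
      a * (c + d) < 2 * b ^ 2 → g a * (g c + g d) ≤ 2 * g b ^ 2)
    {c d : ℝ} (hc : c ∈ J) (hd : d ∈ J) (hdc : d < c) :
    g c + g d = 2 * g ((c + d) / 2) := by
  set m := (c + d) / 2 with hm
  have hdm : d < m := by linarith
  have hmc : m < c := by linarith
  have hmJ : m ∈ J := hJ.out hd hc ⟨hdm.le, hmc.le⟩
  have hR : ∀ x ∈ Ioo m c, x ∈ J := fun x hx => hJ.out hmJ hc ⟨hx.1.le, hx.2.le⟩
  have hL : ∀ x ∈ Ioo d m, x ∈ J := fun x hx => hJ.out hd hmJ ⟨hx.1.le, hx.2.le⟩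
  have hS : 0 < g c + g d := add_pos (hpos c hc) (hpos d hd)
  have hd0 := hJ0 d hd
  have hcd : c + d = 2 * m := by rw [hm]; ring
  apply le_antisymm
  · set L := sSup (g '' Ioo d m)
    have hne : (g '' Ioo d m).Nonempty := (nonempty_Ioo.2 hdm).image g
    have hub : ∀ y ∈ g '' Ioo d m, y ≤ g m := by
      rintro _ ⟨x, hx, rfl⟩
      exact (hg (hL x hx) hmJ hx.2).le
    have hle : ∀ x ∈ Ioo d m, g x ≤ L := fun x hx =>
      le_csSup ⟨g m, hub⟩ (mem_image_of_mem g hx)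
    have hLm : L ≤ g m := csSup_le hne hub
    have hL0 : 0 < L := by
      obtain ⟨x, hx⟩ := nonempty_Ioo.2 hdm
      exact (hpos x (hL x hx)).trans_le (hle x hx)
    have : L ≤ 2 * L ^ 2 / (g c + g d) := by
      refine csSup_le hne ?_
      rintro _ ⟨x, hx, rfl⟩
      have hb : m - (m - x) / 3 ∈ Ioo d m := ⟨by linarith [hx.1, hx.2], by linarith [hx.2]⟩
      rw [le_div_iff₀ hS]
      refine (h₂ x (hL x hx) _ (hL _ hb) c hc d hd hdc ?_).trans ?_
      · rw [hcd]
        nlinarith [sq_pos_of_pos (sub_pos.2 hx.2),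
          mul_pos (hd0.trans_lt hdm) (sub_pos.2 hx.2)]
      · have := hle _ hb
        have := hpos _ (hL _ hb)
        gcongr
    rw [le_div_iff₀ hS] at this
    nlinarith
  · set R := sInf (g '' Ioo m c)
    have hne : (g '' Ioo m c).Nonempty := (nonempty_Ioo.2 hmc).image g
    have hlb : ∀ y ∈ g '' Ioo m c, g m ≤ y := by
      rintro _ ⟨x, hx, rfl⟩
      exact (hg hmJ (hR x hx) hx.1).le
    have hle : ∀ x ∈ Ioo m c, R ≤ g x := fun x hx =>
      csInf_le ⟨g m, hlb⟩ (mem_image_of_mem g hx)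
    have hRm : g m ≤ R := le_csInf hne hlb
    have hR0 : 0 < R := (hpos m hmJ).trans_le hRm
    have : 2 * R ^ 2 / (g c + g d) ≤ R := by
      refine le_csInf hne ?_
      rintro _ ⟨x, hx, rfl⟩
      have hb : m + (x - m) / 3 ∈ Ioo m c := ⟨by linarith [hx.1], by linarith [hx.1, hx.2]⟩
      rw [div_le_iff₀ hS]
      refine le_trans ?_ (h₁ x (hR x hx) _ (hR _ hb) c hc d hd hdc ?_)
      · have := hle _ hb
        gcongr
      · -- Here `(x - m) / 3 < m` is used, which holds because `c = 2 * m - d ≤ 2 * m`.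
        rw [hcd]
        nlinarith [mul_pos (sub_pos.2 hx.1) (by linarith [hx.2] : 0 < 3 * m - (x - m))]
    rw [div_le_iff₀ hS] at this
    nlinarith

theorem mul_eq_sq_of_swap {g : ℝ → ℝ} {I : Set ℝ} {α β : ℝ}
    (haff : ∀ x ∈ interior I, g x = α * x + β)
    (h₁ : ∀ a ∈ I, ∀ b ∈ I, ∀ c ∈ interior I, ∀ d ∈ interior I, d < c →
      2 * b ^ 2 < a * (c + d) → 2 * g b ^ 2 ≤ g a * (g c + g d))
    (h₂ : ∀ a ∈ I, ∀ b ∈ I, ∀ c ∈ interior I, ∀ d ∈ interior I, d < c →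
      a * (c + d) < 2 * b ^ 2 → g a * (g c + g d) ≤ 2 * g b ^ 2)
    {a m b : ℝ} (ha : a ∈ I) (hm : m ∈ interior I) (hb : b ∈ interior I)
    (hb0 : 0 < b) (hab : a * m = b ^ 2) : g a * g m = g b ^ 2 := by
  obtain ⟨ε, hε, hball⟩ := Metric.isOpen_iff.1 isOpen_interior m hm
  have hc : m + ε / 2 ∈ interior I := hball (by
    rw [Metric.mem_ball, Real.dist_eq, abs_lt]; constructor <;> linarith)
  have hd : m - ε / 2 ∈ interior I := hball (by
    rw [Metric.mem_ball, Real.dist_eq, abs_lt]; constructor <;> linarith)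
  have hsum : g (m + ε / 2) + g (m - ε / 2) = 2 * g m := by
    rw [haff _ hc, haff _ hd, haff _ hm]; ring
  have hnhds : ∀ᶠ x in 𝓝 b, x ∈ interior I := isOpen_interior.mem_nhds hb
  have hcont : ContinuousAt (fun x => g x ^ 2) b := by
    have : ContinuousAt (fun x => (α * x + β) ^ 2) b := by fun_prop
    refine this.congr ?_
    filter_upwards [hnhds] with x hx
    rw [haff x hx]
  apply le_antisymm
  · refine ge_of_tendsto (hcont.tendsto.mono_left (nhdsWithin_le_nhds (s := Ioi b))) ?_
    filter_upwards [hnhds.filter_mono nhdsWithin_le_nhds, self_mem_nhdsWithin] with x hx hxb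
    have := h₂ a ha x (interior_subset hx) _ hc _ hd (by linarith) (by
      have : b ^ 2 < x ^ 2 := pow_lt_pow_left₀ hxb hb0.le two_ne_zero
      nlinarith)
    rw [hsum] at this
    linarith
  · refine le_of_tendsto (hcont.tendsto.mono_left (nhdsWithin_le_nhds (s := Iio b))) ?_
    filter_upwards [hnhds.filter_mono nhdsWithin_le_nhds, self_mem_nhdsWithin,
      nhdsWithin_le_nhds (lt_mem_nhds hb0)] with x hx hxb hx0
    have := h₁ a ha x (interior_subset hx) _ hc _ hd (by linarith) (by
      have : x ^ 2 < b ^ 2 := pow_lt_pow_left₀ hxb (le_of_lt hx0) two_ne_zero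
      nlinarith)
    rw [hsum] at this
    linarith

theorem nontrivial_interior {I : Set ℝ} (hI : I.OrdConnected) (hI' : I.Nontrivial) :
    (interior I).Nontrivial := by
  obtain ⟨p, hp, q, hq, hpq⟩ := hI'.exists_lt
  have hsub : Ioo p q ⊆ interior I :=
    interior_maximal (Ioo_subset_Icc_self.trans (hI.out hp hq)) isOpen_Ioo
  exact ((Ioo_infinite hpq).nontrivial).mono hsub

/-- A point strictly between two points of an order-connected set is an interior point. -/
theorem mem_interior_of_between {I : Set ℝ} (hI : I.OrdConnected) {p q x : ℝ} (hp : p ∈ I)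
    (hq : q ∈ I) (h : p < x) (h' : x < q) : x ∈ interior I :=
  interior_maximal (Ioo_subset_Icc_self.trans (hI.out hp hq)) isOpen_Ioo ⟨h, h'⟩

/-- The functional inequalities coming from the matrices `symThree a b b c d c` force linearity:
they give midpoint-affinity on the interior, then vanishing of the constant term by the
multiplicative relation `g a * g m = g (√(a m)) ^ 2`, which also determines the values at the
endpoints. -/
theorem exists_linear_of_swap {g : ℝ → ℝ} {I : Set ℝ} (hI : I.OrdConnected)
    (hI0 : ∀ x ∈ I, 0 ≤ x) (hI' : I.Nontrivial) (hg : StrictMonoOn g I)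
    (hpos : ∀ x ∈ interior I, 0 < g x)
    (h₁ : ∀ a ∈ I, ∀ b ∈ I, ∀ c ∈ interior I, ∀ d ∈ interior I, d < c →
      2 * b ^ 2 < a * (c + d) → 2 * g b ^ 2 ≤ g a * (g c + g d))
    (h₂ : ∀ a ∈ I, ∀ b ∈ I, ∀ c ∈ interior I, ∀ d ∈ interior I, d < c →
      a * (c + d) < 2 * b ^ 2 → g a * (g c + g d) ≤ 2 * g b ^ 2) :
    ∃ α : ℝ, 0 < α ∧ ∀ x ∈ I, g x = α * x := by
  have hsub : interior I ⊆ I := interior_subset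
  have hJ : (interior I).OrdConnected := (hI.convex.interior).ordConnected
  have hJ' := nontrivial_interior hI hI'
  have hJ0 : ∀ x ∈ interior I, 0 < x := fun x hx => by
    have : x ∈ interior (Ici (0 : ℝ)) := interior_mono hI0 hx
    simpa using this
  obtain ⟨α, β, haff⟩ : ∃ α β : ℝ, ∀ x ∈ interior I, g x = α * x + β := by
    have hmid : ∀ c ∈ interior I, ∀ d ∈ interior I, d < c → g c + g d = 2 * g ((c + d) / 2) :=
      fun c hc d hd hdc => midpoint_of_swap hJ (fun x hx => (hJ0 x hx).le) (hg.mono hsub) hpos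
        (fun a ha b hb => h₁ a (hsub ha) b (hsub hb))
        (fun a ha b hb => h₂ a (hsub ha) b (hsub hb)) hc hd hdc
    refine exists_affine_of_midpoint hJ hJ' (hg.mono hsub).monotoneOn fun c hc d hd => ?_
    rcases lt_trichotomy d c with h | rfl | h
    · exact hmid c hc d hd h
    · rw [show (d + d) / 2 = d by ring]; ring
    · rw [add_comm (g c), add_comm c]; exact hmid d hd c hc h
  have hmul : ∀ a ∈ I, 0 < a → ∀ m ∈ interior I, √(a * m) ∈ interior I ∧
      g a * g m = g √(a * m) ^ 2 := by
    intro a ha ha0 m hm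
    have hm0 := hJ0 m hm
    have hs : a * m = √(a * m) ^ 2 := (Real.sq_sqrt (by positivity)).symm
    have hb : √(a * m) ∈ interior I := by
      rcases lt_trichotomy a m with h | rfl | h
      · exact mem_interior_of_between hI ha (hsub hm)
          (Real.lt_sqrt_of_sq_lt (by nlinarith))
          ((Real.sqrt_lt' hm0).2 (by nlinarith))
      · rwa [Real.sqrt_mul_self ha0.le]
      · exact mem_interior_of_between hI (hsub hm) ha
          (Real.lt_sqrt_of_sq_lt (by nlinarith))
          ((Real.sqrt_lt' ha0).2 (by nlinarith))
    exact ⟨hb, mul_eq_sq_of_swap haff h₁ h₂ ha hm hb (hJ0 _ hb) hs⟩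
  obtain ⟨p, hp, q, hq, hpq⟩ := hJ'.exists_lt
  have hα : 0 < α := by
    have := hg (hsub hp) (hsub hq) hpq
    rw [haff p hp, haff q hq] at this
    by_contra! hα
    nlinarith
  have hβ : β = 0 := by
    obtain ⟨hb, h⟩ := hmul p (hsub hp) (hJ0 p hp) q hq
    rw [haff p hp, haff q hq, haff _ hb, Real.sqrt_mul (hJ0 p hp).le] at h
    have hp2 := Real.sq_sqrt (hJ0 p hp).le
    have hq2 := Real.sq_sqrt (hJ0 q hq).le
    have hlt : √p < √q := Real.sqrt_lt_sqrt (hJ0 p hp).le hpq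
    have : α * β * (√q - √p) ^ 2 = 0 := by
      linear_combination h + (α * β + α ^ 2 * q) * hp2 + (α * β + α ^ 2 * √p ^ 2) * hq2
    simpa [hα.ne', (sub_pos.2 hlt).ne'] using this
  have hlin : ∀ x ∈ interior I, g x = α * x := fun x hx => by rw [haff x hx, hβ, add_zero]
  refine ⟨α, hα, fun a ha => ?_⟩
  rcases (hI0 a ha).eq_or_lt with rfl | ha0
  · -- If `0 ∈ I`, then `2 * g 0 ^ 2 ≤ g a * (g q + g p)` for all small `a > 0`.
    rw [mul_zero]
    by_contra hne
    have hsq : 0 < g 0 ^ 2 := by positivity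
    have hS : 0 < g q + g p := add_pos (hpos q hq) (hpos p hp)
    have hp0 := hJ0 p hp
    have hx0 : 0 < min (p / 2) (g 0 ^ 2 / (α * (g q + g p))) := by positivity
    set x := min (p / 2) (g 0 ^ 2 / (α * (g q + g p)))
    have hx : x ∈ interior I := mem_interior_of_between hI ha (hsub hp) hx0
      ((min_le_left _ _).trans_lt (half_lt_self hp0))
    have hxle : x * (α * (g q + g p)) ≤ g 0 ^ 2 :=
      (le_div_iff₀ (by positivity)).1 (min_le_right _ _)
    have := h₁ x (hsub hx) 0 ha q hq p hp hpq (by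
      have := hJ0 q hq
      rw [zero_pow two_ne_zero, mul_zero]
      positivity)
    rw [hlin x hx] at this
    nlinarith
  · obtain ⟨hb, h⟩ := hmul a ha ha0 p hp
    have hp0 := hJ0 p hp
    rw [hlin p hp, hlin _ hb, mul_pow, Real.sq_sqrt (by positivity)] at h
    have : α * p * (g a - α * a) = 0 := by linear_combination h
    simpa [hα.ne', hp0.ne', sub_eq_zero] using this

end Analysis

/-! ### Sign preservers as real functions -/

section SignPreservers

open Matrix

theorem isSymm_signPattern {n : Type*} [DecidableEq n] (t y : ℝ) (s : n → ℝ) :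
    (signPattern t y s).IsSymm := by
  ext i j
  by_cases h : i = j
  · subst h; rfl
  · simp [signPattern, h, Ne.symm h, mul_right_comm]

theorem map_signPattern_one {n : Type*} [DecidableEq n] (g : ℝ → ℝ) (t y : ℝ) :
    (signPattern t y (1 : n → ℝ)).map g = signPattern (g t) (g y) 1 := by
  ext i j
  simp only [signPattern, map_apply, of_apply, Pi.one_apply, mul_one]
  split_ifs <;> rfl

theorem signPattern_one_mem {n : Type*} [DecidableEq n] {Ω : Set ℝ} {t y : ℝ} (ht : t ∈ Ω)
    (hy : y ∈ Ω) (i j : n) : signPattern t y 1 i j ∈ Ω := by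
  simp only [signPattern, of_apply, Pi.one_apply, mul_one]
  split_ifs <;> assumption

/-- The vector of signs with `-1` at `i₀` and `1` elsewhere. -/
def flipSign {n : Type*} [DecidableEq n] (i₀ : n) (i : n) : ℝ := if i = i₀ then -1 else 1

theorem flipSign_mul_self {n : Type*} [DecidableEq n] (i₀ i : n) :
    flipSign i₀ i * flipSign i₀ i = 1 := by
  unfold flipSign
  split_ifs <;> norm_num

theorem signPattern_flipSign_mem {n : Type*} [DecidableEq n] {Ω : Set ℝ} {t y : ℝ} (i₀ : n)
    (ht : t ∈ Ω) (hy : y ∈ Ω) (hy' : -y ∈ Ω) (i j : n) :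
    signPattern t y (flipSign i₀) i j ∈ Ω := by
  simp only [signPattern, of_apply, flipSign]
  split_ifs <;> simpa

theorem signPattern_flipSign_apply {n : Type*} [DecidableEq n] {t y : ℝ} {i₀ j : n}
    (h : i₀ ≠ j) : signPattern t y (flipSign i₀) i₀ j = -y := by
  simp [signPattern, flipSign, h, h.symm]

theorem symThree_mem {Ω : Set ℝ} {a b c d e r : ℝ} (ha : a ∈ Ω) (hb : b ∈ Ω) (hc : c ∈ Ω)
    (hd : d ∈ Ω) (he : e ∈ Ω) (hr : r ∈ Ω) (i j : Fin 3) : symThree a b c d e r i j ∈ Ω := by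
  fin_cases i <;> fin_cases j <;> simpa [symThree]

theorem isSymm_repeatLast {n : ℕ} {B : Matrix (Fin 3) (Fin 3) ℝ} (hB : B.IsSymm) (t : ℝ) :
    (repeatLast n B t).IsSymm := by
  ext i j
  by_cases h : i = j
  · subst h; rfl
  · simp [repeatLast, h, Ne.symm h, hB.apply]

theorem repeatLast_mem {n : ℕ} {Ω : Set ℝ} {B : Matrix (Fin 3) (Fin 3) ℝ} {t : ℝ}
    (hB : ∀ i j, B i j ∈ Ω) (ht : t ∈ Ω) (i j : Fin n) : repeatLast n B t i j ∈ Ω := by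
  simp only [repeatLast, of_apply]
  split_ifs
  · exact ht
  · exact hB _ _

open Classical in
/-- The real part of `f : Ω → ℂ`, extended by zero to a function on `ℝ`. -/
noncomputable def reExtension {Ω : Set ℝ} (f : Ω → ℂ) (x : ℝ) : ℝ :=
  if h : x ∈ Ω then (f ⟨x, h⟩).re else 0

theorem eq_reExtension {Ω : Set ℝ} {f : Ω → ℂ} {x : Ω} (h : (f x).im = 0) :
    f x = (reExtension f x : ℂ) := by
  apply Complex.ext <;> simp [reExtension, h]

/-- On a symmetric matrix the image under `f` can only be Hermitian if `f` is real at every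
entry. -/
theorem im_eq_zero_of_isHermitian {n : Type*} {Ω : Set ℝ} {f : Ω → ℂ} {A : Matrix n n Ω}
    (hA : A.IsSymm) (h : (A.map f).IsHermitian) (i j : n) : (f (A i j)).im = 0 := by
  have := h.apply i j
  rw [map_apply, map_apply, hA.apply] at this
  exact Complex.conj_eq_iff_im.1 this

theorem exists_lift {n : Type*} {Ω : Set ℝ} {A : Matrix n n ℝ} (hA : A.IsSymm)
    (hmem : ∀ i j, A i j ∈ Ω) :
    ∃ A' : Matrix n n Ω, A'.IsSymm ∧ A'.map (fun x : Ω => (x : ℝ)) = A :=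
  ⟨of fun i j => ⟨A i j, hmem i j⟩, by ext i j; simp [hA.apply], rfl⟩

theorem map_eq_map_ofReal {n : Type*} {Ω : Set ℝ} {f : Ω → ℂ} {g : ℝ → ℝ}
    (hf : ∀ x : Ω, f x = (g x : ℂ)) (A : Matrix n n Ω) :
    A.map f = ((A.map (fun x : Ω => (x : ℝ))).map g).map Complex.ofReal := by
  ext i j
  simp [hf]

theorem IsPDSignPreserver.posDef_iff {n : ℕ} {Ω : Set ℝ} {f : Ω → ℂ} {g : ℝ → ℝ}
    (h : IsPDSignPreserver n Ω f) (hf : ∀ x : Ω, f x = (g x : ℂ))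
    {A : Matrix (Fin n) (Fin n) ℝ} (hA : A.IsSymm) (hmem : ∀ i j, A i j ∈ Ω) :
    A.PosDef ↔ (A.map g).PosDef := by
  obtain ⟨A', hA', rfl⟩ := exists_lift hA hmem
  rw [h A' hA', map_eq_map_ofReal hf, posDef_map_ofReal_iff]

theorem IsPSDSignPreserver.posSemidef_iff {n : ℕ} {Ω : Set ℝ} {f : Ω → ℂ} {g : ℝ → ℝ}
    (h : IsPSDSignPreserver n Ω f) (hf : ∀ x : Ω, f x = (g x : ℂ))
    {A : Matrix (Fin n) (Fin n) ℝ} (hA : A.IsSymm) (hmem : ∀ i j, A i j ∈ Ω) :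
    A.PosSemidef ↔ (A.map g).PosSemidef := by
  obtain ⟨A', hA', rfl⟩ := exists_lift hA hmem
  rw [h A' hA', map_eq_map_ofReal hf, posSemidef_map_ofReal_iff]

theorem map_smul_of_linear {n : Type*} {Ω : Set ℝ} {f : Ω → ℂ} {α : ℝ}
    (hf : ∀ x : Ω, f x = (α : ℂ) * ((x : ℝ) : ℂ)) (A : Matrix n n Ω) :
    A.map f = (α • A.map (fun x : Ω => (x : ℝ))).map Complex.ofReal := by
  ext i j
  simp [hf]

theorem mem_neg_part {Ω : Set ℝ} (hmod : ModulusClosed Ω) {x : ℝ} (hx : x ∈ Ω)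
    (hxI : x ∉ nonnegPart Ω) : x < 0 ∧ |x| = -x ∧ -x ∈ nonnegPart Ω := by
  have hx0 : x < 0 := by
    by_contra! h
    exact hxI ⟨hx, h⟩
  have := abs_of_neg hx0
  exact ⟨hx0, this, this ▸ hmod x hx, by simpa using hx0.le⟩

theorem exists_lt_of_mem_interior {I : Set ℝ} {c : ℝ} (hc : c ∈ interior I) :
    (∃ t ∈ I, c < t) ∧ ∃ t ∈ I, t < c := by
  obtain ⟨ε, hε, hball⟩ := Metric.isOpen_iff.1 isOpen_interior c hc
  refine ⟨⟨c + ε / 2, interior_subset (hball ?_), by linarith⟩,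
    ⟨c - ε / 2, interior_subset (hball ?_), by linarith⟩⟩ <;>
  · rw [Metric.mem_ball, Real.dist_eq, abs_lt]
    constructor <;> linarith

/-- Linearity on the nonnegative part, from implications that hold both for positive definite and
for positive semidefinite sign preservers. -/
theorem exists_linear_of_preserver {I : Set ℝ} (hI : I.OrdConnected) (hI0 : ∀ x ∈ I, 0 ≤ x)
    (hI' : I.Nontrivial) {g : ℝ → ℝ} (hg : StrictMonoOn g I) (hpos : ∀ x ∈ interior I, 0 < g x)
    (h : ∀ B : Matrix (Fin 3) (Fin 3) ℝ, B.IsSymm → (∀ i j, B i j ∈ I) → (∃ t ∈ I, B 2 2 < t) →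
      (B.PosDef → (B.map g).PosSemidef) ∧ ((B.map g).PosDef → B.PosSemidef)) :
    ∃ α : ℝ, 0 < α ∧ ∀ x ∈ I, g x = α * x := by
  have hsub : interior I ⊆ I := interior_subset
  have key : ∀ a ∈ I, ∀ b ∈ I, ∀ c ∈ interior I, ∀ d ∈ interior I,
      ((symThree a b b c d c).PosDef →
        (symThree (g a) (g b) (g b) (g c) (g d) (g c)).PosSemidef) ∧
      ((symThree (g a) (g b) (g b) (g c) (g d) (g c)).PosDef →
        (symThree a b b c d c).PosSemidef) := by
    intro a ha b hb c hc d hd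
    have := h (symThree a b b c d c) (isHermitian_iff_isSymm.1 (isHermitian_symThree ..))
      (symThree_mem ha hb hb (hsub hc) (hsub hd) (hsub hc)) (exists_lt_of_mem_interior hc).1
    rwa [map_symThree] at this
  refine exists_linear_of_swap hI hI0 hI' hg hpos ?_ ?_
  · intro a ha b hb c hc d hd hdc hlt
    exact le_of_posSemidef_symThree_swap (hg (hsub hd) (hsub hc) hdc)
      ((key a ha b hb c hc d hd).1 (posDef_symThree_swap (hI0 d (hsub hd)) hdc hlt))
  · intro a ha b hb c hc d hd hdc hlt
    by_contra! hcon
    exact hlt.not_ge (le_of_posSemidef_symThree_swap hdc ((key a ha b hb c hc d hd).2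
      (posDef_symThree_swap (hpos d hd).le (hg (hsub hd) (hsub hc) hdc) hcon)))

/-! ### Positive definite sign preservers -/

theorem IsPDSignPreserver.im_eq_zero {n : ℕ} (hn : 3 ≤ n) {Ω : Set ℝ} (hmod : ModulusClosed Ω)
    (hI' : (nonnegPart Ω).Nontrivial) (hΩ : IsPDType Ω) {f : Ω → ℂ}
    (h : IsPDSignPreserver n Ω f) (x : Ω) : (f x).im = 0 := by
  obtain ⟨i, j, hij⟩ : ∃ i j : Fin n, i ≠ j :=
    ⟨⟨0, by omega⟩, ⟨1, by omega⟩, by simp⟩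
  obtain ⟨A, hA, hmem, hpd, k, l, hkl⟩ : ∃ A : Matrix (Fin n) (Fin n) ℝ, A.IsSymm ∧
      (∀ i j, A i j ∈ Ω) ∧ A.PosDef ∧ ∃ k l, A k l = x := by
    by_cases hx : (x : ℝ) ∈ nonnegPart Ω
    · obtain ⟨z, hz, hzx⟩ := hI'.exists_ne (x : ℝ)
      rcases hzx.lt_or_gt with hlt | hlt
      · exact ⟨signPattern x z 1, isSymm_signPattern .., signPattern_one_mem hx.1 hz.1,
          posDef_signPattern hz.2 hlt (by simp), i, i, by simp [signPattern]⟩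
      · exact ⟨signPattern z x 1, isSymm_signPattern .., signPattern_one_mem hz.1 hx.1,
          posDef_signPattern hx.2 hlt (by simp), i, j, by simp [signPattern, hij]⟩
    · obtain ⟨-, habs, hy⟩ := mem_neg_part hmod x.2 hx
      obtain ⟨ε, hε, ht⟩ := hΩ x ⟨x.2, hx⟩
      rw [habs] at ht
      exact ⟨signPattern (-x + ε) (-x) (flipSign i), isSymm_signPattern ..,
        signPattern_flipSign_mem i ht.1 hy.1 (by simp),
        posDef_signPattern hy.2 (by linarith) (flipSign_mul_self i), i, j, by
          simp [signPattern_flipSign_apply hij]⟩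
  obtain ⟨A', hA', rfl⟩ := exists_lift hA hmem
  have hx : A' k l = x := Subtype.ext hkl
  rw [← hx]
  exact im_eq_zero_of_isHermitian hA' ((h A' hA').1 hpd).isHermitian k l

theorem IsPDSignPreserver.exists_linear {n : ℕ} (hn : 3 ≤ n) {Ω : Set ℝ}
    (hmod : ModulusClosed Ω) (hI : (nonnegPart Ω).OrdConnected)
    (hI' : (nonnegPart Ω).Nontrivial) (hΩ : IsPDType Ω) {f : Ω → ℂ}
    (h : IsPDSignPreserver n Ω f) :
    ∃ α : ℝ, 0 < α ∧ ∀ x : Ω, f x = (α : ℂ) * ((x : ℝ) : ℂ) := by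
  set g := reExtension f
  have hfg : ∀ x : Ω, f x = (g x : ℂ) := fun x =>
    eq_reExtension (h.im_eq_zero hn hmod hI' hΩ x)
  obtain ⟨i, j, hij⟩ : ∃ i j : Fin n, i ≠ j :=
    ⟨⟨0, by omega⟩, ⟨1, by omega⟩, by simp⟩
  have hpair : ∀ v ∈ nonnegPart Ω, ∀ u ∈ nonnegPart Ω, v < u → 0 < g u ∧ g v < g u := by
    intro v hv u hu hvu
    have hpd := (h.posDef_iff hfg (isSymm_signPattern u v 1)
      (signPattern_one_mem hu.1 hv.1)).1 (posDef_signPattern hv.2 hvu (by simp))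
    rw [map_signPattern_one] at hpd
    have h0 : 0 < g u := by simpa [signPattern] using hpd.diag_pos (i := i)
    have h2 : g v ^ 2 < g u * g u := by simpa [signPattern, hij] using hpd.sq_lt_mul_diag hij
    exact ⟨h0, lt_of_pow_lt_pow_left₀ 2 h0.le (by linarith)⟩
  have hmono : StrictMonoOn g (nonnegPart Ω) := fun v hv u hu hvu => (hpair v hv u hu hvu).2
  have hpos : ∀ x ∈ interior (nonnegPart Ω), 0 < g x := fun x hx => by
    obtain ⟨t, ht, htx⟩ := (exists_lt_of_mem_interior hx).2
    exact (hpair t ht x (interior_subset hx) htx).1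
  have hthree : ∀ B : Matrix (Fin 3) (Fin 3) ℝ, B.IsSymm → (∀ i j, B i j ∈ Ω) →
      B 2 2 ∈ nonnegPart Ω → (∃ t ∈ nonnegPart Ω, B 2 2 < t) →
      (B.PosDef ↔ (B.map g).PosDef) := by
    rintro B hB hmem h2 ⟨t, ht, hlt⟩
    have := h.posDef_iff hfg (isSymm_repeatLast (n := n) hB t) (repeatLast_mem hmem ht.1)
    rwa [map_repeatLast, posDef_repeatLast_iff hn hlt,
      posDef_repeatLast_iff hn (hmono h2 ht hlt)] at this
  obtain ⟨α, hα, hlin⟩ := exists_linear_of_preserver hI (fun x hx => hx.2) hI' hmono hpos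
    fun B hB hmem ht => by
      have := hthree B hB (fun i j => (hmem i j).1) (hmem 2 2) ht
      exact ⟨fun hpd => (this.1 hpd).posSemidef, fun hpd => (this.2 hpd).posSemidef⟩
  refine ⟨α, hα, fun x => ?_⟩
  suffices g x = α * x by rw [hfg x, this]; push_cast; rfl
  by_cases hx : (x : ℝ) ∈ nonnegPart Ω
  · exact hlin x hx
  obtain ⟨hx0, habs, hyI⟩ := mem_neg_part hmod x.2 hx
  obtain ⟨ε, hε, htI⟩ := hΩ x ⟨x.2, hx⟩
  rw [habs] at htI
  obtain ⟨y, hy⟩ : ∃ y : ℝ, y = -x := ⟨_, rfl⟩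
  rw [← hy] at hyI htI
  have hy0 : 0 < y := by linarith
  have hxy : (x : ℝ) = -y := by linarith
  rw [hxy]
  have hyΩ : -y ∈ Ω := hxy ▸ x.2
  have hmemI : ∀ s, 0 ≤ s → s ≤ ε → y + s ∈ nonnegPart Ω := fun s hs hs' =>
    hI.out hyI htI ⟨by linarith, by linarith⟩
  -- With a slightly larger diagonal, a single pair of entries `-y` among entries `y` destroys
  -- positivity, so `g (-y)` and `g y` differ.
  have hne : g (-y) ≠ α * y := by
    intro heq
    obtain ⟨s, hs0, hsε, hsy⟩ : ∃ s, 0 < s ∧ s < ε ∧ s ≤ y :=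
      ⟨min (ε / 2) y, by positivity, (min_le_left _ _).trans_lt (by linarith), min_le_right _ _⟩
    have ht := hmemI s hs0.le hsε.le
    have hpd : (symThree (y + s) (-y) y (y + s) y (y + s)).PosDef := by
      refine (hthree _ (isHermitian_iff_isSymm.1 (isHermitian_symThree ..))
        (symThree_mem ht.1 hyΩ hyI.1 ht.1 hyI.1 ht.1) ht ⟨_, htI, ?_⟩).2 ?_
      · simp [symThree, hsε]
      rw [map_symThree, heq, hlin y hyI, hlin _ ht]
      have h1 : 0 < α * (y + s) := by positivity
      refine posDef_symThree h1 ?_ ?_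
      · have : α * y < α * (y + s) := by gcongr; linarith
        rw [← sq]; gcongr
      · have : 0 < α ^ 3 * (s ^ 2 * (3 * y + s)) := by positivity
        nlinarith
    have hdet := hpd.det_pos
    rw [det_symThree] at hdet
    have : (s - y) * (2 * y + s) ^ 2 ≤ 0 :=
      mul_nonpos_of_nonpos_of_nonneg (by linarith) (sq_nonneg _)
    nlinarith
  have hupper : g (-y) ^ 2 ≤ (α * y) ^ 2 := by
    have hlt : ∀ s, 0 < s → s ≤ ε → g (-y) ^ 2 ≤ (α * (y + s)) ^ 2 := by
      intro s hs hsε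
      have ht := hmemI s hs.le hsε
      have hpd := (h.posDef_iff hfg (isSymm_signPattern (y + s) y (flipSign i))
        (signPattern_flipSign_mem i ht.1 hyI.1 hyΩ)).1
        (posDef_signPattern hy0.le (by linarith) (flipSign_mul_self i))
      have := hpd.sq_lt_mul_diag hij
      simp only [map_apply, signPattern_flipSign_apply hij] at this
      simp only [signPattern, of_apply, if_true, hlin _ ht] at this
      linarith
    have hcont : ContinuousWithinAt (fun s : ℝ => (α * (y + s)) ^ 2) (Set.Ioi 0) 0 := by fun_prop
    have := ge_of_tendsto hcont.tendsto (b := g (-y) ^ 2) (by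
      filter_upwards [Ioc_mem_nhdsGT hε] with s hs
      exact hlt s hs.1 hs.2)
    simpa using this
  -- The matrix below is singular for the entry `-y`, but an entry of smaller modulus in the place
  -- of `-y` would make it positive definite.
  have hlower : (α * y) ^ 2 ≤ g (-y) ^ 2 := by
    by_contra! hlt
    obtain ⟨s, hs0, rfl⟩ : ∃ s, 0 < s ∧ ε = 5 * s := ⟨ε / 5, by positivity, by ring⟩
    have h1 := hmemI s hs0.le (by linarith)
    have h2 := hmemI (2 * s) (by linarith) (by linarith)
    have h4 := hmemI (4 * s) (by linarith) (by linarith)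
    have hpd : (symThree y (-y) (-y) (y + s) (y + 2 * s) (y + 4 * s)).PosDef := by
      refine (hthree _ (isHermitian_iff_isSymm.1 (isHermitian_symThree ..))
        (symThree_mem hyI.1 hyΩ hyΩ h1.1 h2.1 h4.1) h4 ⟨_, htI, ?_⟩).2 ?_
      · simp only [symThree, of_apply, cons_val]
        linarith
      rw [map_symThree, hlin y hyI, hlin _ h1, hlin _ h2, hlin _ h4]
      refine posDef_symThree (by positivity) ?_ ?_
      · have : 0 < α ^ 2 * y * s := by positivity
        nlinarith
      · have : 0 < α * s * ((α * y) ^ 2 - g (-y) ^ 2) :=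
          mul_pos (mul_pos hα hs0) (sub_pos.2 hlt)
        nlinarith
    have hdet := hpd.det_pos
    rw [det_symThree] at hdet
    nlinarith
  rcases sq_eq_sq_iff_eq_or_eq_neg.1 (le_antisymm hupper hlower) with h' | h'
  · exact absurd h' hne
  · rw [h']; ring

/-! ### Positive semidefinite sign preservers -/

theorem IsPSDSignPreserver.im_eq_zero {n : ℕ} (hn : 3 ≤ n) {Ω : Set ℝ} (hmod : ModulusClosed Ω)
    {f : Ω → ℂ} (h : IsPSDSignPreserver n Ω f) (x : Ω) : (f x).im = 0 := by
  obtain ⟨i, j, hij⟩ : ∃ i j : Fin n, i ≠ j :=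
    ⟨⟨0, by omega⟩, ⟨1, by omega⟩, by simp⟩
  obtain ⟨A, hA, hmem, hpd, k, l, hkl⟩ : ∃ A : Matrix (Fin n) (Fin n) ℝ, A.IsSymm ∧
      (∀ i j, A i j ∈ Ω) ∧ A.PosSemidef ∧ ∃ k l, A k l = x := by
    by_cases hx : (x : ℝ) ∈ nonnegPart Ω
    · exact ⟨signPattern x x 1, isSymm_signPattern .., signPattern_one_mem hx.1 hx.1,
        posSemidef_signPattern hx.2 le_rfl (by simp), i, i, by simp [signPattern]⟩
    · obtain ⟨-, habs, hy⟩ := mem_neg_part hmod x.2 hx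
      exact ⟨signPattern (-x) (-x) (flipSign i), isSymm_signPattern ..,
        signPattern_flipSign_mem i hy.1 hy.1 (by simp),
        posSemidef_signPattern hy.2 le_rfl (flipSign_mul_self i), i, j, by
          simp [signPattern_flipSign_apply hij]⟩
  obtain ⟨A', hA', rfl⟩ := exists_lift hA hmem
  have hx : A' k l = x := Subtype.ext hkl
  rw [← hx]
  exact im_eq_zero_of_isHermitian hA' ((h A' hA').1 hpd).isHermitian k l

theorem IsPSDSignPreserver.exists_linear {n : ℕ} (hn : 3 ≤ n) {Ω : Set ℝ}
    (hmod : ModulusClosed Ω) (hI : (nonnegPart Ω).OrdConnected)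
    (hI' : (nonnegPart Ω).Nontrivial) (hΩ : IsPSDType Ω) {f : Ω → ℂ}
    (h : IsPSDSignPreserver n Ω f) :
    ∃ α : ℝ, 0 < α ∧ ∀ x : Ω, f x = (α : ℂ) * ((x : ℝ) : ℂ) := by
  set g := reExtension f
  have hfg : ∀ x : Ω, f x = (g x : ℂ) := fun x => eq_reExtension (h.im_eq_zero hn hmod x)
  obtain ⟨i, j, hij⟩ : ∃ i j : Fin n, i ≠ j :=
    ⟨⟨0, by omega⟩, ⟨1, by omega⟩, by simp⟩
  have hnonneg : ∀ v ∈ nonnegPart Ω, 0 ≤ g v := by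
    intro v hv
    have hpsd := (h.posSemidef_iff hfg (isSymm_signPattern v v 1)
      (signPattern_one_mem hv.1 hv.1)).1 (posSemidef_signPattern hv.2 le_rfl (by simp))
    simpa [signPattern] using hpsd.diag_nonneg (i := i)
  have hmono : StrictMonoOn g (nonnegPart Ω) := by
    intro v hv u hu hvu
    by_contra! hle
    have hpsd : (signPattern v u (1 : Fin n → ℝ)).PosSemidef := by
      refine (h.posSemidef_iff hfg (isSymm_signPattern ..) (signPattern_one_mem hv.1 hu.1)).2 ?_
      rw [map_signPattern_one]
      exact posSemidef_signPattern (hnonneg u hu) hle (by simp)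
    have : u ^ 2 ≤ v * v := by simpa [signPattern, hij] using hpsd.sq_le_mul_diag i j
    have := hv.2
    simp only [Set.mem_Ici] at this
    nlinarith
  have hpos : ∀ x ∈ interior (nonnegPart Ω), 0 < g x := fun x hx => by
    obtain ⟨t, ht, htx⟩ := (exists_lt_of_mem_interior hx).2
    exact (hnonneg t ht).trans_lt (hmono ht (interior_subset hx) htx)
  have hthree : ∀ B : Matrix (Fin 3) (Fin 3) ℝ, B.IsSymm → (∀ i j, B i j ∈ Ω) →
      (B.PosSemidef ↔ (B.map g).PosSemidef) := by
    intro B hB hmem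
    have := h.posSemidef_iff hfg (isSymm_repeatLast (n := n) hB (B 2 2))
      (repeatLast_mem hmem (hmem 2 2))
    rwa [map_repeatLast, posSemidef_repeatLast_iff hn (B := B) le_rfl,
      posSemidef_repeatLast_iff hn (B := B.map g) (t := g (B 2 2)) le_rfl] at this
  obtain ⟨α, hα, hlin⟩ := exists_linear_of_preserver hI (fun x hx => hx.2) hI' hmono hpos
    fun B hB hmem _ => by
      have := hthree B hB (fun i j => (hmem i j).1)
      exact ⟨fun hpd => this.1 hpd.posSemidef, fun hpd => this.2 hpd.posSemidef⟩
  refine ⟨α, hα, fun x => ?_⟩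
  suffices g x = α * x by rw [hfg x, this]; push_cast; rfl
  by_cases hx : (x : ℝ) ∈ nonnegPart Ω
  · exact hlin x hx
  obtain ⟨hx0, habs, hyI⟩ := mem_neg_part hmod x.2 hx
  obtain ⟨δ, hδ, hzI⟩ := hΩ x ⟨x.2, hx⟩
  rw [habs] at hzI
  obtain ⟨y, hy⟩ : ∃ y : ℝ, y = -x := ⟨_, rfl⟩
  rw [← hy] at hyI hzI
  have hy0 : 0 < y := by linarith
  have hxy : (x : ℝ) = -y := by linarith
  rw [hxy]
  have hyΩ : -y ∈ Ω := hxy ▸ x.2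
  -- A single pair of entries `-y` in a matrix with all other entries `y` destroys positivity, so
  -- `g (-y)` and `g y` differ.
  have hne : g (-y) ≠ α * y := by
    intro heq
    have hpsd : (symThree y (-y) y y y y).PosSemidef := by
      refine (hthree _ (isHermitian_iff_isSymm.1 (isHermitian_symThree ..))
        (symThree_mem hyI.1 hyΩ hyI.1 hyI.1 hyI.1 hyI.1)).2 ?_
      rw [map_symThree, heq, hlin y hyI]
      convert posSemidef_signPattern (n := Fin 3) (s := 1) (mul_pos hα hy0).le le_rfl (by simp)
        using 1
      ext k l
      fin_cases k <;> fin_cases l <;> simp [symThree, signPattern]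
    have hdet := hpsd.det_nonneg
    rw [det_symThree] at hdet
    have : 0 < y ^ 3 := by positivity
    nlinarith
  have hupper : g (-y) ^ 2 ≤ (α * y) ^ 2 := by
    have hpsd := (h.posSemidef_iff hfg (isSymm_signPattern y y (flipSign i))
      (signPattern_flipSign_mem i hyI.1 hyI.1 hyΩ)).1
      (posSemidef_signPattern hy0.le le_rfl (flipSign_mul_self i))
    have := hpsd.sq_le_mul_diag i j
    simp only [map_apply, signPattern_flipSign_apply hij] at this
    simp only [signPattern, of_apply, if_true, hlin _ hyI] at this
    linarith
  -- An entry of modulus less than `y` in the place of `-y` would allow a diagonal entry `p < y`.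
  have hlower : (α * y) ^ 2 ≤ g (-y) ^ 2 := by
    by_contra! hlt
    have hlt' : |g (-y)| < α * y := by
      simpa [abs_of_pos (mul_pos hα hy0)] using sq_lt_sq.1 hlt
    obtain ⟨p, hp, hpy⟩ := exists_between
      (max_lt ((div_lt_iff₀' hα).2 hlt') (by linarith : y - δ < y))
    obtain ⟨hp1, hp2⟩ := max_lt_iff.1 hp
    have hpI : p ∈ nonnegPart Ω := hI.out hzI hyI ⟨hp2.le, hpy.le⟩
    have hp0 : 0 < p := (div_nonneg (abs_nonneg _) hα.le).trans_lt hp1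
    have hpsd : (symThree p (-y) (-y) y p y).PosSemidef := by
      refine (hthree _ (isHermitian_iff_isSymm.1 (isHermitian_symThree ..))
        (symThree_mem hpI.1 hyΩ hyΩ hyI.1 hpI.1 hyI.1)).2 ?_
      rw [map_symThree, hlin y hyI, hlin p hpI]
      refine (posDef_symThree_swap (by positivity) (by gcongr) ?_).posSemidef
      have h1 : |g (-y)| < α * p := (div_lt_iff₀' hα).1 hp1
      have h2 : g (-y) ^ 2 < (α * p) ^ 2 := by
        rw [← sq_abs]; gcongr
      have h3 : (α * p) * (α * p) < (α * p) * (α * y) := by gcongr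
      linarith
    have := le_of_posSemidef_symThree_swap hpy hpsd
    nlinarith
  rcases sq_eq_sq_iff_eq_or_eq_neg.1 (le_antisymm hupper hlower) with h' | h'
  · exact absurd h' hne
  · rw [h']; ring

end SignPreservers

theorem theoremB (n : ℕ) (hn : 3 ≤ n) (Ω : Set ℝ) (hmod : ModulusClosed Ω)
    (hI : (nonnegPart Ω).OrdConnected) (hI' : (nonnegPart Ω).Nontrivial) (f : Ω → ℂ) :
    (IsPDType Ω →
      (IsPDSignPreserver n Ω f ↔
        ∃ α : ℝ, 0 < α ∧ ∀ x : Ω, f x = (α : ℂ) * ((x : ℝ) : ℂ))) ∧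
    (IsPSDType Ω →
      (IsPSDSignPreserver n Ω f ↔
        ∃ α : ℝ, 0 < α ∧ ∀ x : Ω, f x = (α : ℂ) * ((x : ℝ) : ℂ))) := by
  refine ⟨fun hΩ => ⟨fun h => h.exists_linear hn hmod hI hI' hΩ, ?_⟩,
    fun hΩ => ⟨fun h => h.exists_linear hn hmod hI hI' hΩ, ?_⟩⟩
  · rintro ⟨α, hα, hf⟩ A -
    rw [map_smul_of_linear hf, Matrix.posDef_map_ofReal_iff, Matrix.posDef_smul_iff hα]
  · rintro ⟨α, hα, hf⟩ A -
    rw [map_smul_of_linear hf, Matrix.posSemidef_map_ofReal_iff, Matrix.posSemidef_smul_iff hα]
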